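/- Let $N<d$, $\mathbf X\in\mathbb R^{N\times d}$, $\mathbf y\in\mathbb R^N$, $\eta>0$, $0\le\tau\le 1$, let $L(\mathbf w)=\frac12\|\mathbf X\mathbf w-\mathbf y\|_2^2$ for $\mathbf w\in\mathbb R^d$, and let $\mathcal E=\{\mathbf w\in\mathbb R^d:\mathbf X\mathbf w=\mathbf y\}$. Put $\log_\tau x=\frac{x^{1-\tau}-1}{1-\tau}$ and $\exp_\tau x=[1+(1-\tau)x]_+^{1/(1-\tau)}$ for $\tau<1$, $\log_1=\log$, $\exp_1=\exp$, and, coordinatewise, $q_\tau(\mathbf u)=\left(\frac{2-\tau}{2}\right)^{\frac{2}{2-\tau}}|\mathbf u|^{\frac{2}{2-\tau}}$. For each sufficiently small $\alpha>0$ let $(\mathbf u_+,\mathbf u_-)=(\mathbf u_+^{\alpha},\mathbf u_-^{\alpha}):[0,\infty)\to\mathbb R^d\times\mathbb R^d$ be a continuous solution of the reparameterized tempered EGU$^\pm$ gradient flow $$\dot{\mathbf u}_+(t)=-\eta\,\nabla_{\mathbf u_+}L\big(q_\tau(\mathbf u_+(t))-q_\tau(\mathbf u_-(t))\big),\qquad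 \dot{\mathbf u}_-(t)=-\eta\,\nabla_{\mathbf u_-}L\big(q_\tau(\mathbf u_+(t))-q_\tau(\mathbf u_-(t))\big),$$ with $q_\tau(\mathbf u_+(0))=q_\tau(\mathbf u_-(0))=\alpha\mathbf 1$, and let $\mathbf w^\alpha(t)=q_\tau(\mathbf u_+(t))-q_\tau(\mathbf u_-(t))$. (The equations are understood in integral form; for $\tau=0$ a partial derivative at a coordinate where $|u|$ has its kink and which does not exist there is taken to be $0$.) If $\tau<1$, where coordinates can reach $0$ and the flow alone does not determine how they continue, the solution is the one that follows the clipping in $\exp_\tau$: for all $t\ge 0$ and all $i$, $u_{\pm,i}(t)=0$ if and only if $\exp_\tau\big(\log_\tau\alpha\mp\eta\int_0^t(\nabla L(\mathbf w^\alpha(z)))_i\,dz\big)=0$. Assume that for each sufficiently small $\alpha>0$ the limit $\mathbf w^\alpha(\infty)=\lim_{t\to\infty}\mathbf w^\alpha(t)$ exists and lies in $\mathcal E$. Then, as $\alpha\to0^+$, $\mathbf w^\alpha(\infty)$ converges to a solution of minimum $\mathrm L_{2-\tau}$-norm in $\mathcal E$, that is, to some $\mathbf w^*\in\mathcal E$ with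 $\|\mathbf w^*\|_{2-\tau}\le\|\mathbf w\|_{2-\tau}$ for all $\mathbf w\in\mathcal E$. -/

import Mathlib

open Set Filter Topology MeasureTheory

noncomputable section

namespace TemperedEGU

/-- The tempered logarithm `log_τ x = (x ^ (1 - τ) - 1) / (1 - τ)`, with `log_1 = log`. -/
def logT (τ x : ℝ) : ℝ :=
  if τ = 1 then Real.log x else (x ^ (1 - τ) - 1) / (1 - τ)

/-- The tempered exponential `exp_τ x = [1 + (1 - τ) x]_+ ^ (1 / (1 - τ))`, with `exp_1 = exp`. -/
def expT (τ x : ℝ) : ℝ :=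
  if τ = 1 then Real.exp x else (max 0 (1 + (1 - τ) * x)) ^ (1 / (1 - τ))

/-- The reparameterization function
`q_τ(u) = ((2 - τ) / 2) ^ (2 / (2 - τ)) * |u| ^ (2 / (2 - τ))`, applied coordinatewise. -/
def qT {d : ℕ} (τ : ℝ) (u : Fin d → ℝ) : Fin d → ℝ :=
  fun i => ((2 - τ) / 2) ^ (2 / (2 - τ)) * |u i| ^ (2 / (2 - τ))

/-- The loss `L(w) = ½ ‖X w - y‖²` of linear regression with design matrix `X` and targets `y`. -/
def loss {N d : ℕ} (X : Matrix (Fin N) (Fin d) ℝ) (y : Fin N → ℝ) (w : Fin d → ℝ) : ℝ :=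
  (1 / 2) * ∑ n, ((X.mulVec w) n - y n) ^ 2

/-- The vector of partial derivatives of `F` at `u`. Where a partial derivative does not exist,
`deriv` is `0`. Below this happens only for `τ = 0` at a coordinate `u i = 0`, at the kink of
`|u i|`, where it is the usual convention `sign 0 = 0`; it is immaterial there, since an
absolutely continuous function has derivative `0` at almost every point of its zero set. -/
def grad {d : ℕ} (F : (Fin d → ℝ) → ℝ) (u : Fin d → ℝ) : Fin d → ℝ :=
  fun i => deriv (fun s => F (Function.update u i s)) (u i)

/-- The weights `w(t) = q_τ(u₊(t)) - q_τ(u₋(t))`. -/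
def weights {d : ℕ} (τ : ℝ) (up um : ℝ → Fin d → ℝ) (t : ℝ) : Fin d → ℝ :=
  qT τ (up t) - qT τ (um t)

/-- `(u₊, u₋)` solves, for `t ≥ 0`, the gradient flow
`u₊' = -η ∇_{u₊} L(q_τ(u₊) - q_τ(u₋))`, `u₋' = -η ∇_{u₋} L(q_τ(u₊) - q_τ(u₋))`,
with `q_τ(u₊(0)) = q_τ(u₋(0)) = α 𝟏`. The equations are read in integral form. This is the same
as the differential form when `τ > 0`, where the right-hand sides are continuous; when `τ = 0`
they have jumps at `u i = 0`, and these are solutions in the sense of Carathéodory. -/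
structure IsGradientFlow {N d : ℕ} (X : Matrix (Fin N) (Fin d) ℝ) (y : Fin N → ℝ)
    (η τ α : ℝ) (up um : ℝ → Fin d → ℝ) : Prop where
  continuousOn_up : ContinuousOn up (Ici 0)
  continuousOn_um : ContinuousOn um (Ici 0)
  init_up : qT τ (up 0) = fun _ => α
  init_um : qT τ (um 0) = fun _ => α
  flow_up : ∀ t, 0 ≤ t → ∀ i, up t i = up 0 i -
    η * ∫ z in (0 : ℝ)..t, grad (fun v => loss X y (qT τ v - qT τ (um z))) (up z) i
  flow_um : ∀ t, 0 ≤ t → ∀ i, um t i = um 0 i -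
    η * ∫ z in (0 : ℝ)..t, grad (fun v => loss X y (qT τ (up z) - qT τ v)) (um z) i

/-- The rule that fixes how a solution of the gradient flow is continued once a coordinate has
reached `0`; for `τ < 1` the flow itself does not determine this. A coordinate of `u₊` or `u₋`
is `0` at exactly those times at which its link variable `log_τ α ∓ η ∫₀ᵗ (∇L(w(z)))_i dz`
is in the clipped range of `exp_τ`, that is, has tempered exponential `0`. -/
def FollowsClipping {N d : ℕ} (X : Matrix (Fin N) (Fin d) ℝ) (y : Fin N → ℝ)
    (η τ α : ℝ) (up um : ℝ → Fin d → ℝ) : Prop :=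
  ∀ t, 0 ≤ t → ∀ i,
    (up t i = 0 ↔ expT τ (logT τ α -
      η * ∫ z in (0 : ℝ)..t, grad (loss X y) (weights τ up um z) i) = 0) ∧
    (um t i = 0 ↔ expT τ (logT τ α +
      η * ∫ z in (0 : ℝ)..t, grad (loss X y) (weights τ up um z) i) = 0)

/-- The `L_p` norm `(∑ |w_i| ^ p) ^ (1 / p)` of a vector. -/
def lpNorm {d : ℕ} (p : ℝ) (w : Fin d → ℝ) : ℝ :=
  (∑ i, |w i| ^ p) ^ (1 / p)

end TemperedEGU

end

/-! Since `q_τ'² = q_τ^τ`, the flow moves `log_τ (q_τ(u_±,i))` with velocity `∓η (∇L(w))_i` wherever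
`u_±,i ≠ 0`. The clipping rule fixes the constant each time a coordinate leaves zero, so with `G =
∫₀ᵗ ∇L(w)` every weight has the closed form `w_i = exp_τ(log_τ α - η G_i) - exp_τ(log_τ α + η G_i)`
(`weights_eq`). As `∇L = Xᵀ(Xw - y)`, `G` is orthogonal to `ker X`
(`sum_integral_grad_mul_eq_zero`). Inverting the closed form therefore turns this orthogonality into
a stationarity condition for `w(∞)` on the affine space `Xw = y`.

For `τ < 1` the inverse is the gradient of `|w|^(2-τ)/(2-τ)` up to `2 α^(1-τ)`
(`abs_sub_signedPow_le`). The limits are thus approximately stationary for a strictly convex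
objective, and they converge to its unique minimizer.

For `τ = 1` stationarity is exact for the hypentropy, which expands as `|w| log(1/α) + |w| log |w| -
|w| + o(1)` for fixed `w`. The leading term forces a minimal `ℓ¹` norm. Such minimizers need not be
unique; the next term selects one (`entropic_minimizer_unique`), and this makes the whole family
converge rather than just subsequences. -/

namespace TemperedEGU

/-! ### The scalar reparameterization and the chain rule for the loss -/

/-- The reparameterization function of one real variable. -/
noncomputable def qScalar (τ s : ℝ) : ℝ := ((2 - τ) / 2) ^ (2 / (2 - τ)) * |s| ^ (2 / (2 - τ))

/-- The derivative of `qScalar τ`, with the value `0` at `0`. -/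
noncomputable def qScalarDeriv (τ s : ℝ) : ℝ :=
  ((2 - τ) / 2 * |s|) ^ (2 / (2 - τ) - 1) * SignType.sign s

lemma qT_apply {d : ℕ} (τ : ℝ) (u : Fin d → ℝ) (i : Fin d) : qT τ u i = qScalar τ (u i) := rfl

lemma qScalar_nonneg {τ : ℝ} (hτ : τ ≤ 1) (s : ℝ) : 0 ≤ qScalar τ s := by
  unfold qScalar
  have : 0 ≤ (2 - τ) / 2 := by linarith
  positivity

lemma qScalar_eq {τ : ℝ} (hτ : τ ≤ 1) (s : ℝ) :
    qScalar τ s = ((2 - τ) / 2 * |s|) ^ (2 / (2 - τ)) := by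
  rw [Real.mul_rpow (by linarith) (abs_nonneg s), qScalar]

lemma qScalar_neg (τ s : ℝ) : qScalar τ (-s) = qScalar τ s := by simp [qScalar]

lemma qScalar_zero {τ : ℝ} (hτ : τ ≤ 1) : qScalar τ 0 = 0 := by
  have : 2 / (2 - τ) ≠ 0 := by
    have : (2 - τ) ≠ 0 := by linarith
    positivity
  simp [qScalar, Real.zero_rpow this]

lemma continuous_qScalar {τ : ℝ} (hτ : τ ≤ 1) : Continuous (qScalar τ) := by
  unfold qScalar
  refine continuous_const.mul (continuous_abs.rpow_const fun _ => Or.inr ?_)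
  have : 0 < 2 - τ := by linarith
  positivity

lemma hasDerivAt_qScalar {τ : ℝ} (hτ : τ ≤ 1) {s : ℝ} (hs : s ≠ 0) :
    HasDerivAt (qScalar τ) (qScalarDeriv τ s) s := by
  have h2 : 0 < 2 - τ := by linarith
  have h := ((hasDerivAt_abs hs).rpow_const (p := 2 / (2 - τ))
    (Or.inl (abs_ne_zero.2 hs))).const_mul (((2 - τ) / 2) ^ (2 / (2 - τ)))
  refine h.congr_deriv ?_
  have hβ : 0 < (2 - τ) / 2 := by positivity
  rw [qScalarDeriv, Real.mul_rpow hβ.le (abs_nonneg s), Real.rpow_sub_one hβ.ne']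
  field_simp

lemma measurable_qScalarDeriv (τ : ℝ) : Measurable (qScalarDeriv τ) := by
  have h : Measurable fun s : ℝ => ((SignType.sign s : SignType) : ℝ) := by
    have : (fun s : ℝ => ((SignType.sign s : SignType) : ℝ)) =
        fun s => if 0 < s then 1 else if s < 0 then -1 else 0 := by
      ext s
      rcases lt_trichotomy s 0 with h | h | h
      · simp [h, not_lt.2 h.le]
      · simp [h]
      · simp [h]
    rw [this]
    exact Measurable.ite measurableSet_Ioi measurable_const
      (Measurable.ite measurableSet_Iio measurable_const measurable_const)
  unfold qScalarDeriv
  exact ((measurable_const.mul measurable_abs).pow_const _).mul h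

lemma continuousAt_qScalarDeriv {τ : ℝ} (hτ : τ ≤ 1) {s : ℝ} (hs : s ≠ 0) :
    ContinuousAt (qScalarDeriv τ) s := by
  have h2 : 0 < (2 - τ) / 2 := by linarith
  have hsgn : ContinuousAt (fun s : ℝ => ((SignType.sign s : SignType) : ℝ)) s :=
    (continuous_of_discreteTopology (f := fun a : SignType => (a : ℝ))).continuousAt.comp
      (continuousAt_sign_of_ne_zero hs)
  unfold qScalarDeriv
  refine ContinuousAt.mul (ContinuousAt.rpow_const (by fun_prop) (Or.inl ?_)) hsgn
  have := abs_pos.2 hs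
  positivity

/-- The exponent `2 / (2 - τ) - 1 = τ / (2 - τ)` lies in `[0, 1]`. The bound makes the flow's
integrand integrable even when it jumps at `0`, as for `τ = 0`. -/
lemma abs_qScalarDeriv_le {τ : ℝ} (hτ0 : 0 ≤ τ) (hτ : τ ≤ 1) (s : ℝ) :
    |qScalarDeriv τ s| ≤ 1 + |s| := by
  have h2 : 0 < 2 - τ := by linarith
  have h3 : (2 - τ) / 2 * |s| ≤ 1 + |s| := by nlinarith [abs_nonneg s]
  have h4 : 0 ≤ (2 - τ) / 2 * |s| := by positivity
  have hp0 : 0 ≤ 2 / (2 - τ) - 1 := by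
    rw [sub_nonneg, le_div_iff₀ h2]; linarith
  have hp1 : 2 / (2 - τ) - 1 ≤ 1 := by
    rw [sub_le_iff_le_add, div_le_iff₀ h2]; linarith
  have hsg : |((SignType.sign s : SignType) : ℝ)| ≤ 1 := by
    rcases lt_trichotomy s 0 with h | h | h <;> simp [h]
  rw [qScalarDeriv, abs_mul, abs_of_nonneg (Real.rpow_nonneg h4 _)]
  calc _ ≤ ((2 - τ) / 2 * |s|) ^ (2 / (2 - τ) - 1) * 1 := by gcongr
    _ ≤ (1 + |s|) ^ (2 / (2 - τ) - 1) := by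
        rw [mul_one]; exact Real.rpow_le_rpow h4 h3 hp0
    _ ≤ (1 + |s|) ^ (1 : ℝ) := Real.rpow_le_rpow_of_exponent_le (by linarith [abs_nonneg s]) hp1
    _ = _ := Real.rpow_one _

variable {N d : ℕ} (X : Matrix (Fin N) (Fin d) ℝ) (y : Fin N → ℝ)

lemma hasDerivAt_loss_comp {φ : ℝ → Fin d → ℝ} {s c : ℝ} {i : Fin d}
    (h : HasDerivAt φ (Pi.single i c) s) :
    HasDerivAt (fun s => loss X y (φ s))
      (c * ∑ n, (X.mulVec (φ s) n - y n) * X n i) s := by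
  have hφ : ∀ n, HasDerivAt (fun s => X.mulVec (φ s) n) (X n i * c) s := by
    intro n
    have h' := HasDerivAt.fun_sum (u := Finset.univ) (A := fun j s => X n j * φ s j)
      (A' := fun j => X n j * (Pi.single i c : Fin d → ℝ) j) (x := s)
      fun j _ => ((hasDerivAt_pi.1 h) j).const_mul (X n j)
    simpa [Pi.single_apply, Matrix.mulVec, dotProduct] using h'
  have h1 := (HasDerivAt.fun_sum (u := Finset.univ) fun n _ =>
    ((hφ n).sub_const (y n)).pow 2).const_mul (1 / 2 : ℝ)
  refine h1.congr_deriv ?_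
  rw [Finset.mul_sum, Finset.mul_sum]
  refine Finset.sum_congr rfl fun n _ => ?_
  simp
  ring

lemma grad_loss (w : Fin d → ℝ) (i : Fin d) :
    grad (loss X y) w i = ∑ n, (X.mulVec w n - y n) * X n i := by
  have h := hasDerivAt_loss_comp X y (hasDerivAt_update w i (w i))
  simpa [grad] using h.deriv

/-- Reflection gives `deriv f 0 = -deriv f 0`, with no differentiability needed. This covers
vanishing coordinates in the chain rule, including the kink at `τ = 0`. -/
lemma deriv_zero_of_even {f : ℝ → ℝ} (hf : ∀ s, f (-s) = f s) : deriv f 0 = 0 := by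
  have h := deriv_comp_neg f (0 : ℝ)
  simp only [hf, neg_zero] at h
  linarith

lemma qT_update (τ : ℝ) (v : Fin d → ℝ) (i : Fin d) (s : ℝ) :
    qT τ (Function.update v i s) = Function.update (qT τ v) i (qScalar τ s) := by
  ext j
  rcases eq_or_ne j i with rfl | h
  · simp [qT_apply]
  · simp [qT_apply, h]

lemma hasDerivAt_qT_update {τ : ℝ} (hτ : τ ≤ 1) {v : Fin d → ℝ} {i : Fin d} (hv : v i ≠ 0) :
    HasDerivAt (fun s => qT τ (Function.update v i s)) (Pi.single i (qScalarDeriv τ (v i)))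
      (v i) := by
  rw [hasDerivAt_pi]
  intro j
  simp only [qT_update]
  rcases eq_or_ne j i with rfl | h
  · simpa using hasDerivAt_qScalar hτ hv
  · simpa [h] using hasDerivAt_const (v i) (qT τ v j)

lemma grad_loss_qT_left {τ : ℝ} (hτ : τ ≤ 1) (v w₀ : Fin d → ℝ) (i : Fin d) :
    grad (fun v => loss X y (qT τ v - w₀)) v i =
      qScalarDeriv τ (v i) * grad (loss X y) (qT τ v - w₀) i := by
  rcases eq_or_ne (v i) 0 with hv | hv
  · have : deriv (fun s => loss X y (qT τ (Function.update v i s) - w₀)) 0 = 0 :=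
      deriv_zero_of_even fun s => by simp only [qT_update, qScalar_neg]
    simp [grad, hv, this, qScalarDeriv]
  · have h := hasDerivAt_loss_comp X y ((hasDerivAt_qT_update hτ hv).sub_const w₀)
    rw [grad_loss]
    simpa [grad] using h.deriv

lemma grad_loss_qT_right {τ : ℝ} (hτ : τ ≤ 1) (v w₀ : Fin d → ℝ) (i : Fin d) :
    grad (fun v => loss X y (w₀ - qT τ v)) v i =
      qScalarDeriv τ (v i) * -grad (loss X y) (w₀ - qT τ v) i := by
  rcases eq_or_ne (v i) 0 with hv | hv
  · have : deriv (fun s => loss X y (w₀ - qT τ (Function.update v i s))) 0 = 0 :=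
      deriv_zero_of_even fun s => by simp only [qT_update, qScalar_neg]
    simp [grad, hv, this, qScalarDeriv]
  · have h := (hasDerivAt_qT_update hτ hv).const_sub w₀
    rw [← Pi.single_neg] at h
    have h := hasDerivAt_loss_comp X y h
    rw [grad_loss]
    simpa [grad] using h.deriv

end TemperedEGU

/-! ### Closed form of one coordinate of the flow -/

namespace TemperedEGU

lemma expT_logT_sub {τ : ℝ} (hτ : τ < 1) (α x : ℝ) :
    expT τ (logT τ α - x) = (max 0 (α ^ (1 - τ) - (1 - τ) * x)) ^ (1 / (1 - τ)) := by
  have h : 1 - τ ≠ 0 := by linarith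
  rw [expT, logT, if_neg hτ.ne, if_neg hτ.ne]
  congr 2
  field_simp
  ring

lemma expT_logT_sub_eq_zero_iff {τ : ℝ} (hτ : τ < 1) (α x : ℝ) :
    expT τ (logT τ α - x) = 0 ↔ α ^ (1 - τ) - (1 - τ) * x ≤ 0 := by
  have h : 0 < 1 - τ := by linarith
  rw [expT_logT_sub hτ, Real.rpow_eq_zero (le_max_left _ _) (by positivity), max_eq_left_iff]

/-- The identity behind the choice of `q_τ`: one factor `q_τ'` comes from the flow, one from
differentiating `q_τ(u)`, and `q_τ^(-τ)` is the derivative of `log_τ`. -/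
lemma qScalarDeriv_sq_mul {τ : ℝ} (hτ : τ ≤ 1) {s : ℝ} (hs : s ≠ 0) :
    qScalarDeriv τ s * qScalarDeriv τ s * qScalar τ s ^ (-τ) = 1 := by
  have h2 : 0 < 2 - τ := by linarith
  have hx : 0 < (2 - τ) / 2 * |s| := by have := abs_pos.2 hs; positivity
  have hsg : ((SignType.sign s : SignType) : ℝ) * (SignType.sign s : SignType) = 1 := by
    rcases hs.lt_or_gt with h | h <;> simp [h]
  rw [qScalar_eq hτ, qScalarDeriv]
  generalize (2 - τ) / 2 * |s| = x at hx
  rw [mul_mul_mul_comm, hsg, mul_one, ← Real.rpow_add hx, ← Real.rpow_mul hx.le,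
    ← Real.rpow_add hx]
  convert Real.rpow_zero x using 2
  field_simp
  ring

section Scalar

variable {τ η α : ℝ} {u g : ℝ → ℝ}

lemma intervalIntegrable_qScalarDeriv_mul (hτ0 : 0 ≤ τ) (hτ : τ ≤ 1) (hu : Continuous u)
    (hg : Continuous g) (a b : ℝ) :
    IntervalIntegrable (fun z => qScalarDeriv τ (u z) * g z) volume a b := by
  have hc : Continuous fun z => (1 + |u z|) * |g z| := by fun_prop
  refine (hc.intervalIntegrable a b).mono_fun
    (((measurable_qScalarDeriv τ).comp hu.measurable).mul hg.measurable).aestronglyMeasurable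
    (Eventually.of_forall fun z => ?_)
  simp only [Real.norm_eq_abs]
  rw [abs_mul, abs_of_nonneg (a := (1 + |u z|) * |g z|) (by positivity)]
  exact mul_le_mul_of_nonneg_right (abs_qScalarDeriv_le hτ0 hτ _) (abs_nonneg _)

lemma hasDerivAt_of_flow (hτ0 : 0 ≤ τ) (hτ : τ ≤ 1) (hu : Continuous u) (hg : Continuous g)
    (hflow : ∀ t, 0 ≤ t → u t = u 0 - η * ∫ z in (0 : ℝ)..t, qScalarDeriv τ (u z) * g z)
    {t : ℝ} (ht : 0 < t) (hut : u t ≠ 0) :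
    HasDerivAt u (-(η * (qScalarDeriv τ (u t) * g t))) t := by
  have hm := ((measurable_qScalarDeriv τ).comp hu.measurable).mul hg.measurable
  have h := intervalIntegral.integral_hasDerivAt_right
    (intervalIntegrable_qScalarDeriv_mul hτ0 hτ hu hg 0 t)
    hm.stronglyMeasurable.stronglyMeasurableAtFilter
    (((continuousAt_qScalarDeriv hτ hut).comp hu.continuousAt).mul hg.continuousAt)
  refine ((h.const_mul η).const_sub (u 0)).congr_of_eventuallyEq ?_
  filter_upwards [lt_mem_nhds ht] with s hs using hflow s hs.le

/-- Along the flow, the tempered logarithm of `q_τ(u)` moves with velocity `-η g` as long as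
`u ≠ 0`. -/
lemma rpow_qScalar_add_eq (hτ0 : 0 ≤ τ) (hτ : τ < 1) (hu : Continuous u) (hg : Continuous g)
    (hflow : ∀ t, 0 ≤ t → u t = u 0 - η * ∫ z in (0 : ℝ)..t, qScalarDeriv τ (u z) * g z)
    {a t : ℝ} (ha : 0 ≤ a) (hat : a ≤ t) (hut : ∀ s ∈ Ioo a t, u s ≠ 0) :
    qScalar τ (u t) ^ (1 - τ) + (1 - τ) * (η * ∫ z in (0 : ℝ)..t, g z) =
      qScalar τ (u a) ^ (1 - τ) + (1 - τ) * (η * ∫ z in (0 : ℝ)..a, g z) := by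
  rcases hat.eq_or_lt with rfl | hlt
  · rfl
  have hG : ∀ s, HasDerivAt (fun t => ∫ z in (0 : ℝ)..t, g z) (g s) s := fun s =>
    intervalIntegral.integral_hasDerivAt_right (hg.intervalIntegrable _ _)
      hg.measurable.stronglyMeasurable.stronglyMeasurableAtFilter hg.continuousAt
  have hGc : Continuous fun t => ∫ z in (0 : ℝ)..t, g z :=
    continuous_iff_continuousAt.2 fun s => (hG s).continuousAt
  have hψc : Continuous fun s => qScalar τ (u s) ^ (1 - τ) +
      (1 - τ) * (η * ∫ z in (0 : ℝ)..s, g z) := by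
    have : Continuous fun s => qScalar τ (u s) ^ (1 - τ) :=
      ((continuous_qScalar hτ.le).comp hu).rpow_const fun _ => Or.inr (by linarith)
    fun_prop
  -- The mean value theorem needs a derivative only in the open interval, so `u` may vanish at the
  -- endpoints.
  obtain ⟨c, -, hc⟩ := exists_hasDerivAt_eq_slope
    (fun s => qScalar τ (u s) ^ (1 - τ) + (1 - τ) * (η * ∫ z in (0 : ℝ)..s, g z))
    (fun _ => 0) hlt hψc.continuousOn (by
      intro s hs
      have hus := hut s hs
      have hq : qScalar τ (u s) ≠ 0 := by
        have h2 : 0 < (2 - τ) / 2 := by linarith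
        have := abs_pos.2 hus
        rw [qScalar]; positivity
      have h1 := ((hasDerivAt_qScalar hτ.le hus).comp s
        (hasDerivAt_of_flow hτ0 hτ.le hu hg hflow (ha.trans_lt hs.1) hus)).rpow_const
        (p := 1 - τ) (Or.inl hq)
      have h2 := h1.add (((hG s).const_mul η).const_mul (1 - τ))
      refine h2.congr_deriv ?_
      have h3 := qScalarDeriv_sq_mul hτ.le hus
      have h4 : 1 - τ - 1 = -τ := by ring
      simp only [Function.comp_apply]
      rw [h4]
      linear_combination (-(η * g s * (1 - τ))) * h3)
  have := sub_pos.2 hlt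
  rw [eq_div_iff this.ne'] at hc
  linarith

/-- If `u t ≠ 0`, go back to the last zero `a` before `t`. By the clipping rule the link variable is
in the clipped range at `a` and outside it right after, so by continuity it sits exactly at the
threshold. The conservation law on `(a, t)` then starts with the same constant as from time `0`.
Without such an `a`, it applies from time `0` directly. -/
lemma qScalar_flow_of_lt (hτ0 : 0 ≤ τ) (hτ : τ < 1) (hu : Continuous u)
    (hg : Continuous g) (h0 : qScalar τ (u 0) = α)
    (hflow : ∀ t, 0 ≤ t → u t = u 0 - η * ∫ z in (0 : ℝ)..t, qScalarDeriv τ (u z) * g z)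
    (hclip : ∀ t, 0 ≤ t → (u t = 0 ↔ expT τ (logT τ α - η * ∫ z in (0 : ℝ)..t, g z) = 0))
    {t : ℝ} (ht : 0 ≤ t) :
    qScalar τ (u t) = expT τ (logT τ α - η * ∫ z in (0 : ℝ)..t, g z) := by
  have hτ' : 0 < 1 - τ := by linarith
  by_cases hut : u t = 0
  · rw [(hclip t ht).1 hut, hut, qScalar_zero hτ.le]
  suffices h : qScalar τ (u t) ^ (1 - τ) =
      α ^ (1 - τ) - (1 - τ) * (η * ∫ z in (0 : ℝ)..t, g z) by
    rw [expT_logT_sub hτ, ← h,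
      max_eq_right (Real.rpow_nonneg (qScalar_nonneg hτ.le _) _),
      ← Real.rpow_mul (qScalar_nonneg hτ.le _), mul_one_div_cancel hτ'.ne', Real.rpow_one]
  by_cases hne : (Icc 0 t ∩ u ⁻¹' {0}).Nonempty
  · obtain ⟨a, ⟨⟨ha0, hat⟩, hua : u a = 0⟩, hmax⟩ :=
      (isCompact_Icc.inter_right (isClosed_singleton.preimage hu)).exists_isGreatest hne
    have hat' : a < t := hat.lt_of_ne fun h => hut (h ▸ hua)
    have hpos : ∀ s ∈ Ioc a t, u s ≠ 0 := fun s hs h =>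
      absurd (hmax ⟨⟨ha0.trans hs.1.le, hs.2⟩, h⟩) (not_le.2 hs.1)
    have key := rpow_qScalar_add_eq hτ0 hτ hu hg hflow ha0 hat
      fun s hs => hpos s ⟨hs.1, hs.2.le⟩
    have hle : α ^ (1 - τ) - (1 - τ) * (η * ∫ z in (0 : ℝ)..a, g z) ≤ 0 :=
      (expT_logT_sub_eq_zero_iff hτ _ _).1 ((hclip a ha0).1 hua)
    have hGc : Continuous fun t => ∫ z in (0 : ℝ)..t, g z :=
      intervalIntegral.continuous_primitive (fun _ _ => hg.intervalIntegrable _ _) 0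
    have hge : 0 ≤ α ^ (1 - τ) - (1 - τ) * (η * ∫ z in (0 : ℝ)..a, g z) := by
      have hcont : Continuous fun s => α ^ (1 - τ) - (1 - τ) * (η * ∫ z in (0 : ℝ)..s, g z) := by
        fun_prop
      refine ge_of_tendsto (hcont.continuousWithinAt (s := Ioi a) (x := a)).tendsto ?_
      filter_upwards [Ioc_mem_nhdsGT hat'] with s hs
      have h := mt (hclip s (ha0.trans hs.1.le)).2 (hpos s hs)
      rw [expT_logT_sub_eq_zero_iff hτ, not_le] at h
      exact h.le
    rw [hua, qScalar_zero hτ.le, Real.zero_rpow hτ'.ne'] at key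
    linarith
  · have key := rpow_qScalar_add_eq hτ0 hτ hu hg hflow le_rfl ht
      fun s hs h => hne ⟨s, ⟨hs.1.le, hs.2.le⟩, h⟩
    rw [h0, intervalIntegral.integral_same] at key
    linarith

lemma qScalarDeriv_one (s : ℝ) : qScalarDeriv 1 s = s / 2 := by
  have h : (2 : ℝ) / (2 - 1) - 1 = 1 := by norm_num
  rw [qScalarDeriv, h, Real.rpow_one, mul_assoc, abs_mul_sign]
  ring

lemma qScalar_one (s : ℝ) : qScalar 1 s = s ^ 2 / 4 := by
  have h : (2 : ℝ) / (2 - 1) = (2 : ℕ) := by norm_num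
  rw [qScalar, h, Real.rpow_natCast, Real.rpow_natCast, sq_abs]
  ring

/-- Here the equation is linear in `u`, so the integrating factor `exp (η / 2 * ∫ g)` solves it; no
clipping rule is needed. -/
lemma qScalar_flow_one (hα : 0 < α) (hu : Continuous u)
    (hg : Continuous g) (h0 : qScalar 1 (u 0) = α)
    (hflow : ∀ t, 0 ≤ t → u t = u 0 - η * ∫ z in (0 : ℝ)..t, qScalarDeriv 1 (u z) * g z)
    {t : ℝ} (ht : 0 ≤ t) :
    qScalar 1 (u t) = expT 1 (logT 1 α - η * ∫ z in (0 : ℝ)..t, g z) := by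
  simp only [qScalarDeriv_one] at hflow
  have hprim : ∀ {f : ℝ → ℝ}, Continuous f → ∀ s,
      HasDerivAt (fun t => ∫ z in (0 : ℝ)..t, f z) (f s) s := fun hf s =>
    intervalIntegral.integral_hasDerivAt_right (hf.intervalIntegrable _ _)
      hf.measurable.stronglyMeasurable.stronglyMeasurableAtFilter hf.continuousAt
  have hsol : u t * Real.exp (η / 2 * ∫ z in (0 : ℝ)..t, g z) = u 0 := by
    rcases ht.eq_or_lt with rfl | hlt
    · simp
    have hGc : Continuous fun t => ∫ z in (0 : ℝ)..t, g z :=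
      continuous_iff_continuousAt.2 fun s => (hprim hg s).continuousAt
    obtain ⟨c, -, hc⟩ := exists_hasDerivAt_eq_slope
      (fun s => u s * Real.exp (η / 2 * ∫ z in (0 : ℝ)..s, g z)) (fun _ => 0) hlt
      (by fun_prop) (by
        intro s hs
        have h1 : HasDerivAt u (-(η * (u s / 2 * g s))) s := by
          refine (((hprim (f := fun z => u z / 2 * g z) (by fun_prop) s).const_mul η).const_sub
            (u 0)).congr_of_eventuallyEq ?_
          filter_upwards [lt_mem_nhds hs.1] with r hr using hflow r hr.le
        refine (h1.mul ((hprim hg s).const_mul (η / 2)).exp).congr_deriv ?_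
        ring)
    rw [eq_div_iff (sub_pos.2 hlt).ne'] at hc
    simp at hc
    linarith
  rw [expT, logT, if_pos rfl, if_pos rfl, Real.exp_sub, Real.exp_log hα, ← h0, qScalar_one,
    qScalar_one, ← hsol, mul_pow, ← Real.exp_nat_mul, eq_div_iff (Real.exp_ne_zero _)]
  push_cast
  rw [show (2 : ℝ) * (η / 2 * ∫ z in (0 : ℝ)..t, g z) = η * ∫ z in (0 : ℝ)..t, g z by ring]
  ring

end Scalar

end TemperedEGU

/-! ### Closed form of the weights and stationarity of their limit -/

namespace TemperedEGU

variable {N d : ℕ} {X : Matrix (Fin N) (Fin d) ℝ} {y : Fin N → ℝ} {η τ α : ℝ}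
  {up um : ℝ → Fin d → ℝ}

lemma continuous_qT (hτ : τ ≤ 1) : Continuous (qT τ : (Fin d → ℝ) → Fin d → ℝ) :=
  continuous_pi fun i => (continuous_qScalar hτ).comp (continuous_apply i)

lemma continuous_grad_loss (X : Matrix (Fin N) (Fin d) ℝ) (y : Fin N → ℝ) (i : Fin d) :
    Continuous fun w => grad (loss X y) w i := by
  simp only [grad_loss]
  fun_prop

lemma continuousOn_weights (hτ : τ ≤ 1) (hup : ContinuousOn up (Ici 0))
    (hum : ContinuousOn um (Ici 0)) : ContinuousOn (weights τ up um) (Ici 0) :=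
  ((continuous_qT hτ).comp_continuousOn hup).sub ((continuous_qT hτ).comp_continuousOn hum)

/-- Freezing a trajectory at its initial value for negative times gives the global continuity that
the scalar lemmas assume. -/
lemma continuous_comp_max {E : Type*} [TopologicalSpace E] {f : ℝ → E}
    (hf : ContinuousOn f (Ici 0)) : Continuous fun s => f (max s 0) :=
  hf.comp_continuous (by fun_prop) fun s => le_max_right s 0

lemma integral_comp_max {f : ℝ → ℝ} {t : ℝ} (ht : 0 ≤ t) :
    ∫ z in (0 : ℝ)..t, f (max z 0) = ∫ z in (0 : ℝ)..t, f z := by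
  refine intervalIntegral.integral_congr fun z hz => ?_
  rw [uIcc_of_le ht] at hz
  simp [max_eq_left hz.1]

/-- The closed form of a single coordinate of the flow. -/
lemma qScalar_flow (hτ0 : 0 ≤ τ) (hτ : τ ≤ 1) (hα : 0 < α) {u g : ℝ → ℝ}
    (hu : ContinuousOn u (Ici 0)) (hg : ContinuousOn g (Ici 0)) (h0 : qScalar τ (u 0) = α)
    (hflow : ∀ t, 0 ≤ t → u t = u 0 - η * ∫ z in (0 : ℝ)..t, qScalarDeriv τ (u z) * g z)
    (hclip : τ < 1 → ∀ t, 0 ≤ t →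
      (u t = 0 ↔ expT τ (logT τ α - η * ∫ z in (0 : ℝ)..t, g z) = 0))
    {t : ℝ} (ht : 0 ≤ t) :
    qScalar τ (u t) = expT τ (logT τ α - η * ∫ z in (0 : ℝ)..t, g z) := by
  have hflow' : ∀ t, 0 ≤ t → u (max t 0) = u (max 0 0) -
      η * ∫ z in (0 : ℝ)..t, qScalarDeriv τ (u (max z 0)) * g (max z 0) := by
    intro t ht
    rw [integral_comp_max (f := fun z => qScalarDeriv τ (u z) * g z) ht, max_self,
      max_eq_left ht, ← hflow t ht]
  rcases hτ.eq_or_lt with rfl | hlt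
  · have := qScalar_flow_one hα (continuous_comp_max hu) (continuous_comp_max hg)
      (by simpa using h0) hflow' ht
    rwa [integral_comp_max ht, max_eq_left ht] at this
  · have := qScalar_flow_of_lt hτ0 hlt (continuous_comp_max hu) (continuous_comp_max hg)
      (by simpa using h0) hflow' (fun t ht => by
        rw [integral_comp_max ht, max_eq_left ht]; exact hclip hlt t ht) ht
    rwa [integral_comp_max ht, max_eq_left ht] at this

lemma weights_eq (hτ0 : 0 ≤ τ) (hτ : τ ≤ 1) (hα : 0 < α)
    (hflow : IsGradientFlow X y η τ α up um)
    (hclip : τ < 1 → FollowsClipping X y η τ α up um) {t : ℝ} (ht : 0 ≤ t) (i : Fin d) :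
    weights τ up um t i =
      expT τ (logT τ α - η * ∫ z in (0 : ℝ)..t, grad (loss X y) (weights τ up um z) i) -
      expT τ (logT τ α + η * ∫ z in (0 : ℝ)..t, grad (loss X y) (weights τ up um z) i) := by
  have hg : ContinuousOn (fun z => grad (loss X y) (weights τ up um z) i) (Ici 0) :=
    (continuous_grad_loss X y i).comp_continuousOn
      (continuousOn_weights hτ hflow.continuousOn_up hflow.continuousOn_um)
  have hp := qScalar_flow (η := η) hτ0 hτ hα (u := fun t => up t i)
    ((continuous_apply i).comp_continuousOn hflow.continuousOn_up) hg
    (congrFun hflow.init_up i)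
    (fun t ht => by
      rw [hflow.flow_up t ht i]
      simp only [grad_loss_qT_left X y hτ]
      rfl)
    (fun h t ht => ((hclip h) t ht i).1) ht
  have hm := qScalar_flow (η := η) hτ0 hτ hα (u := fun t => um t i)
    (g := fun z => -grad (loss X y) (weights τ up um z) i)
    ((continuous_apply i).comp_continuousOn hflow.continuousOn_um) hg.neg
    (congrFun hflow.init_um i)
    (fun t ht => by
      rw [hflow.flow_um t ht i]
      simp only [grad_loss_qT_right X y hτ]
      rfl)
    (fun h t ht => by
      simpa using ((hclip h) t ht i).2) ht
  simp only [intervalIntegral.integral_neg, mul_neg, sub_neg_eq_add] at hm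
  rw [← hp, ← hm]
  rfl

/-- The accumulated gradient lies in the row space of `X`. -/
lemma sum_integral_grad_mul_eq_zero (hτ : τ ≤ 1) (hflow : IsGradientFlow X y η τ α up um)
    {x : Fin d → ℝ} (hx : X.mulVec x = 0) {t : ℝ} (ht : 0 ≤ t) :
    ∑ i, (∫ z in (0 : ℝ)..t, grad (loss X y) (weights τ up um z) i) * x i = 0 := by
  have hg : ∀ i, IntervalIntegrable (fun z => grad (loss X y) (weights τ up um z) i * x i)
      volume 0 t := fun i => by
    refine ContinuousOn.intervalIntegrable ?_
    rw [uIcc_of_le ht]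
    exact (((continuous_grad_loss X y i).comp_continuousOn
      (continuousOn_weights hτ hflow.continuousOn_up hflow.continuousOn_um)).mono
      Icc_subset_Ici_self).mul continuousOn_const
  simp only [← intervalIntegral.integral_mul_const]
  rw [← intervalIntegral.integral_finsetSum fun i _ => hg i]
  have : ∀ w : Fin d → ℝ, ∑ i, grad (loss X y) w i * x i = 0 := by
    intro w
    simp only [grad_loss, Finset.sum_mul]
    rw [Finset.sum_comm]
    refine Finset.sum_eq_zero fun n _ => ?_
    have hn : ∑ i, X n i * x i = 0 := congrFun hx n
    simp only [mul_assoc, ← Finset.mul_sum, hn, mul_zero]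
  simp [this]

/-- The gradient `sign w · |w| ^ (1 - τ)` of `|w| ^ (2 - τ) / (2 - τ)`. -/
noncomputable def signedPow (τ w : ℝ) : ℝ := SignType.sign w * |w| ^ (1 - τ)

lemma signedPow_of_nonneg {w : ℝ} (hτ : τ < 1) (hw : 0 ≤ w) : signedPow τ w = w ^ (1 - τ) := by
  rcases hw.eq_or_lt with rfl | h
  · simp [signedPow, Real.zero_rpow (show 1 - τ ≠ 0 by linarith)]
  · simp [signedPow, h, abs_of_pos h]

lemma signedPow_neg (τ w : ℝ) : signedPow τ (-w) = -signedPow τ w := by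
  simp [signedPow, Left.sign_neg]

lemma continuous_signedPow (hτ : τ < 1) : Continuous (signedPow τ) := by
  have h : signedPow τ = fun w => (max w 0) ^ (1 - τ) - (max (-w) 0) ^ (1 - τ) := by
    have h0 : (0 : ℝ) ^ (1 - τ) = 0 := Real.zero_rpow (by linarith)
    ext w
    rcases le_total 0 w with hw | hw
    · rw [signedPow_of_nonneg hτ hw, max_eq_left hw, max_eq_right (by linarith), h0, sub_zero]
    · rw [← neg_neg w, signedPow_neg, signedPow_of_nonneg hτ (by linarith), neg_neg,
        max_eq_right hw, max_eq_left (by linarith), h0, zero_sub]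
  rw [h]
  have h1 : ∀ f : ℝ → ℝ, Continuous f → Continuous fun w => (f w) ^ (1 - τ) := fun f hf =>
    hf.rpow_const fun _ => Or.inr (by linarith)
  exact (h1 _ (by fun_prop)).sub (h1 _ (by fun_prop))

/-- The link function `(A + σ)₊ ^ k - (A - σ)₊ ^ k`, `k = 1 / (1 - τ)`, is inverted by `signedPow`
up to an error of size `2 A`. -/
lemma abs_sub_signedPow_le (hτ : τ < 1) {A : ℝ} (hA : 0 ≤ A) (σ : ℝ) :
    |σ - signedPow τ ((max 0 (A + σ)) ^ (1 / (1 - τ)) - (max 0 (A - σ)) ^ (1 / (1 - τ)))|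
      ≤ 2 * A := by
  have hτ' : 0 < 1 - τ := by linarith
  wlog hσ : 0 ≤ σ generalizing σ
  · have := this (-σ) (by linarith)
    rw [← sub_eq_add_neg, sub_neg_eq_add, ← neg_sub ((max 0 (A + σ)) ^ (1 / (1 - τ))),
      signedPow_neg, ← neg_sub', abs_neg] at this
    exact this
  have hk : 0 < 1 / (1 - τ) := by positivity
  have hpow : ∀ {x : ℝ}, 0 ≤ x → (x ^ (1 / (1 - τ))) ^ (1 - τ) = x := fun hx => by
    rw [← Real.rpow_mul hx, one_div_mul_cancel hτ'.ne', Real.rpow_one]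
  rw [max_eq_right (by linarith : 0 ≤ A + σ)]
  have hle : (max 0 (A - σ)) ^ (1 / (1 - τ)) ≤ (A + σ) ^ (1 / (1 - τ)) :=
    Real.rpow_le_rpow (le_max_left _ _) (max_le (by linarith) (by linarith)) hk.le
  rw [signedPow_of_nonneg hτ (sub_nonneg.2 hle)]
  have h0 := Real.rpow_nonneg (le_max_left 0 (A - σ)) (1 / (1 - τ))
  have hup : ((A + σ) ^ (1 / (1 - τ)) - (max 0 (A - σ)) ^ (1 / (1 - τ))) ^ (1 - τ) ≤ A + σ := by
    calc _ ≤ ((A + σ) ^ (1 / (1 - τ))) ^ (1 - τ) :=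
          Real.rpow_le_rpow (sub_nonneg.2 hle) (by linarith) hτ'.le
      _ = _ := hpow (by linarith)
  have hlow := Real.rpow_nonneg (sub_nonneg.2 hle) (1 - τ)
  rw [abs_le]
  refine ⟨by linarith, ?_⟩
  -- For `σ ≥ A` the subtracted power is clipped and the inverse is exactly `A + σ`; for `σ ≤ A`
  -- nonnegativity of `signedPow` suffices.
  rcases le_total σ A with h | h
  · linarith
  · rw [max_eq_left (by linarith : A - σ ≤ 0), Real.zero_rpow hk.ne', sub_zero,
      hpow (by linarith)]
    linarith

variable {winf : Fin d → ℝ}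

lemma mulVec_sub_eq_zero {v w : Fin d → ℝ} (hv : X.mulVec v = y) (hw : X.mulVec w = y) :
    X.mulVec (v - w) = 0 := by
  rw [Matrix.mulVec_sub, hv, hw, sub_self]

/-- Approximate stationarity of the limit for `τ < 1`. -/
lemma neg_le_sum_signedPow_mul (hτ0 : 0 ≤ τ) (hτ : τ < 1) (hα : 0 < α)
    (hflow : IsGradientFlow X y η τ α up um) (hclip : FollowsClipping X y η τ α up um)
    (hlim : Tendsto (weights τ up um) atTop (𝓝 winf)) (hE : X.mulVec winf = y)
    {v : Fin d → ℝ} (hv : X.mulVec v = y) :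
    -(2 * α ^ (1 - τ) * ∑ i, |v i - winf i|) ≤ ∑ i, signedPow τ (winf i) * (v i - winf i) := by
  have hlim' : Tendsto (fun t => ∑ i, signedPow τ (weights τ up um t i) * (v i - winf i)) atTop
      (𝓝 (∑ i, signedPow τ (winf i) * (v i - winf i))) :=
    tendsto_finsetSum _ fun i _ => (((continuous_signedPow hτ).tendsto _).comp
      (tendsto_pi_nhds.1 hlim i)).mul_const _
  -- The bound is uniform in `t`, so it passes to the limit although `G` need not converge.
  refine ge_of_tendsto hlim' ?_
  filter_upwards [eventually_ge_atTop 0] with t ht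
  set G : Fin d → ℝ := fun i => ∫ z in (0 : ℝ)..t, grad (loss X y) (weights τ up um z) i with hG
  have horth : ∑ i, G i * (v i - winf i) = 0 :=
    sum_integral_grad_mul_eq_zero hτ.le hflow (mulVec_sub_eq_zero hv hE) ht
  have hclose : ∀ i, |-((1 - τ) * (η * G i)) - signedPow τ (weights τ up um t i)|
      ≤ 2 * α ^ (1 - τ) := fun i => by
    have h := weights_eq hτ0 hτ.le hα hflow (fun _ => hclip) ht i
    rw [← sub_neg_eq_add, expT_logT_sub hτ, expT_logT_sub hτ] at h
    have h' := abs_sub_signedPow_le hτ (Real.rpow_nonneg hα.le (1 - τ))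
      (-((1 - τ) * (η * G i)))
    rw [h]
    simpa [← sub_eq_add_neg] using h'
  have hsum : ∑ i, signedPow τ (weights τ up um t i) * (v i - winf i) =
      ∑ i, (signedPow τ (weights τ up um t i) - -((1 - τ) * (η * G i))) * (v i - winf i) := by
    have : ∑ i, (1 - τ) * η * (G i * (v i - winf i)) = 0 := by
      rw [← Finset.mul_sum, horth, mul_zero]
    rw [← add_zero (∑ i, signedPow τ (weights τ up um t i) * (v i - winf i)), ← this,
      ← Finset.sum_add_distrib]
    exact Finset.sum_congr rfl fun i _ => by ring
  rw [hsum, Finset.mul_sum, ← Finset.sum_neg_distrib]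
  refine Finset.sum_le_sum fun i _ => (neg_le_neg ?_).trans (neg_abs_le _)
  rw [abs_mul, abs_sub_comm]
  exact mul_le_mul_of_nonneg_right (hclose i) (abs_nonneg _)

/-- Stationarity of the limit for `τ = 1`. -/
lemma sum_arsinh_mul_eq_zero (hα : 0 < α) (hflow : IsGradientFlow X y η 1 α up um)
    (hlim : Tendsto (weights 1 up um) atTop (𝓝 winf)) (hE : X.mulVec winf = y)
    {v : Fin d → ℝ} (hv : X.mulVec v = y) :
    ∑ i, Real.arsinh (winf i / (2 * α)) * (v i - winf i) = 0 := by
  have hlim' : Tendsto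
      (fun t => ∑ i, Real.arsinh (weights 1 up um t i / (2 * α)) * (v i - winf i)) atTop
      (𝓝 (∑ i, Real.arsinh (winf i / (2 * α)) * (v i - winf i))) :=
    tendsto_finsetSum _ fun i _ => ((Real.continuous_arsinh.tendsto _).comp
      ((tendsto_pi_nhds.1 hlim i).div_const _)).mul_const _
  refine tendsto_nhds_unique_of_eventuallyEq hlim' tendsto_const_nhds ?_
  filter_upwards [eventually_ge_atTop 0] with t ht
  have horth := sum_integral_grad_mul_eq_zero le_rfl hflow (mulVec_sub_eq_zero hv hE) ht
  calc _ = ∑ i, -η * ((∫ z in (0 : ℝ)..t, grad (loss X y) (weights 1 up um z) i) *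
        (v - winf) i) := by
        refine Finset.sum_congr rfl fun i _ => ?_
        have h := weights_eq zero_le_one le_rfl hα hflow (fun h => absurd h (lt_irrefl _)) ht i
        set G := ∫ z in (0 : ℝ)..t, grad (loss X y) (weights 1 up um z) i
        have h' : weights 1 up um t i / (2 * α) = Real.sinh (-η * G) := by
          rw [h, expT, expT, logT, if_pos rfl, if_pos rfl, if_pos rfl, Real.exp_sub, Real.exp_add,
            Real.exp_log hα, Real.sinh_eq, neg_mul, neg_neg, Real.exp_neg]
          field_simp
        rw [h', Real.arsinh_sinh, Pi.sub_apply, mul_assoc]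
    _ = 0 := by rw [← Finset.mul_sum, horth, mul_zero]

end TemperedEGU

/-! ### Convergence from uniqueness of cluster points -/

namespace TemperedEGU

/-- In a compact set a family with a single cluster point converges. Here `P` is a variational
property that every cluster point inherits and only one point has. -/
lemma exists_tendsto_of_unique_ultrafilter_limit {ι E : Type*} [TopologicalSpace E]
    {l : Filter ι} [NeBot l] {w : ι → E} {K : Set E} (hK : IsCompact K)
    (hw : ∀ᶠ a in l, w a ∈ K) {P : E → Prop}
    (hP : ∀ U : Ultrafilter ι, ↑U ≤ l → ∀ x, Tendsto w U (𝓝 x) → P x)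
    (huniq : ∀ x x', P x → P x' → x = x') :
    ∃ x, P x ∧ Tendsto w l (𝓝 x) := by
  obtain ⟨x, -, hx⟩ := hK.ultrafilter_le_nhds (Ultrafilter.map w (Ultrafilter.of l))
    (le_principal_iff.2 (Ultrafilter.of_le l hw))
  have hPx : P x := hP _ (Ultrafilter.of_le l) x hx
  refine ⟨x, hPx, hK.tendsto_nhds_of_unique_mapClusterPt hw fun x' _ hx' => ?_⟩
  obtain ⟨U, hU, hUx⟩ := mapClusterPt_iff_ultrafilter.1 hx'
  exact huniq _ _ (hP U hU x' hUx) hPx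

lemma mem_closedBall_of_sum_abs_le {d : ℕ} {w : Fin d → ℝ} {C : ℝ} (h : ∑ i, |w i| ≤ C) :
    w ∈ Metric.closedBall (0 : Fin d → ℝ) C := by
  rw [mem_closedBall_zero_iff,
    pi_norm_le_iff_of_nonneg ((Finset.sum_nonneg fun i _ => abs_nonneg _).trans h)]
  exact fun i => (Finset.single_le_sum (f := fun i => |w i|) (fun i _ => abs_nonneg _)
    (Finset.mem_univ i)).trans h

lemma mulVec_midpoint {N d : ℕ} {X : Matrix (Fin N) (Fin d) ℝ} {y : Fin N → ℝ}
    {v w : Fin d → ℝ} (hv : X.mulVec v = y) (hw : X.mulVec w = y) :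
    X.mulVec ((1 / 2 : ℝ) • (v + w)) = y := by
  rw [Matrix.mulVec_smul, Matrix.mulVec_add, hv, hw]
  ext i
  simp only [Pi.smul_apply, Pi.add_apply, smul_eq_mul]
  ring

lemma lpNorm_le_lpNorm {d : ℕ} {p : ℝ} (hp : 0 < p) {v w : Fin d → ℝ}
    (h : ∑ i, |v i| ^ p ≤ ∑ i, |w i| ^ p) : lpNorm p v ≤ lpNorm p w :=
  Real.rpow_le_rpow (Finset.sum_nonneg fun i _ => Real.rpow_nonneg (abs_nonneg _) _) h
    (by positivity)

/-! ### The case `τ < 1`: a strictly convex norm -/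

section StrictlyConvexNorm

variable {τ : ℝ}

lemma signedPow_mul_self (hτ : τ < 1) (w : ℝ) : signedPow τ w * w = |w| ^ (2 - τ) := by
  rcases eq_or_ne w 0 with rfl | hw
  · simp [Real.zero_rpow (show 2 - τ ≠ 0 by linarith)]
  · rw [show 2 - τ = 1 - τ + 1 by ring, Real.rpow_add_one (abs_ne_zero.2 hw), signedPow,
      mul_right_comm, sign_mul_self, mul_comm]

/-- The gradient inequality of a convex function, obtained from Young's inequality with exponents `2
- τ` and `(2 - τ) / (1 - τ)`. -/
lemma signedPow_mul_sub_le (hτ : τ < 1) (v w : ℝ) :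
    (2 - τ) * (signedPow τ w * (v - w)) ≤ |v| ^ (2 - τ) - |w| ^ (2 - τ) := by
  have h1 : 0 < 1 - τ := by linarith
  have h2 : 0 < 2 - τ := by linarith
  have hq : (2 - τ).HolderConjugate ((2 - τ) / (1 - τ)) := by
    rw [Real.holderConjugate_iff]
    refine ⟨by linarith, ?_⟩
    field_simp
    ring
  have hy := Real.young_inequality_of_nonneg (abs_nonneg v)
    (Real.rpow_nonneg (abs_nonneg w) (1 - τ)) hq
  rw [← Real.rpow_mul (abs_nonneg w), mul_div_cancel₀ _ h1.ne'] at hy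
  have hle : signedPow τ w * v ≤ |v| * |w| ^ (1 - τ) := by
    refine (le_abs_self _).trans ?_
    rw [abs_mul, mul_comm, signedPow, abs_mul, abs_of_nonneg (Real.rpow_nonneg (abs_nonneg w) _)]
    refine mul_le_mul_of_nonneg_left ?_ (abs_nonneg v)
    refine mul_le_of_le_one_left (Real.rpow_nonneg (abs_nonneg w) _) ?_
    rcases lt_trichotomy w 0 with h | h | h <;> simp [h]
  rw [mul_sub, signedPow_mul_self hτ, mul_sub]
  have := mul_le_mul_of_nonneg_left (hle.trans hy) h2.le
  have e : (2 - τ) * (|v| ^ (2 - τ) / (2 - τ) + |w| ^ (2 - τ) / ((2 - τ) / (1 - τ))) =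
      |v| ^ (2 - τ) + (1 - τ) * |w| ^ (2 - τ) := by field_simp
  linarith

/-- Strict convexity of `x ^ r` on `[0, ∞)` handles `|v| ≠ |w|`; otherwise `v = -w` and the midpoint
is `0`. -/
lemma abs_midpoint_rpow_lt {r : ℝ} (hr : 1 < r) {v w : ℝ} (h : v ≠ w) :
    |1 / 2 * (v + w)| ^ r < 1 / 2 * |v| ^ r + 1 / 2 * |w| ^ r := by
  have hs := (strictConvexOn_rpow hr)
  have htri : |1 / 2 * (v + w)| ≤ 1 / 2 * |v| + 1 / 2 * |w| := by
    rw [abs_mul, abs_of_pos (by norm_num : (0 : ℝ) < 1 / 2)]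
    linarith [abs_add_le v w]
  rcases eq_or_ne |v| |w| with habs | habs
  · obtain rfl : v = -w := (abs_eq_abs.1 habs).resolve_left h
    have hw : w ≠ 0 := by rintro rfl; simp at h
    have : 0 < |w| ^ r := Real.rpow_pos_of_pos (abs_pos.2 hw) r
    rw [neg_add_cancel, mul_zero, abs_zero, Real.zero_rpow (by linarith), abs_neg]
    linarith
  · exact (Real.rpow_le_rpow (abs_nonneg _) htri (by linarith)).trans_lt
      (hs.2 (abs_nonneg v) (abs_nonneg w) habs (by norm_num) (by norm_num) (by norm_num))

lemma abs_midpoint_rpow_le {r : ℝ} (hr : 1 < r) (v w : ℝ) :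
    |1 / 2 * (v + w)| ^ r ≤ 1 / 2 * |v| ^ r + 1 / 2 * |w| ^ r := by
  rcases eq_or_ne v w with rfl | h
  · rw [← two_mul, ← mul_assoc]
    norm_num
    linarith
  · exact (abs_midpoint_rpow_lt hr h).le

lemma abs_le_one_add_abs_rpow {r : ℝ} (hr : 1 ≤ r) (w : ℝ) : |w| ≤ 1 + |w| ^ r := by
  have h0 := Real.rpow_nonneg (abs_nonneg w) r
  rcases le_total |w| 1 with h | h
  · linarith
  · have := Real.rpow_le_rpow_of_exponent_le h hr
    rw [Real.rpow_one] at this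
    linarith

/-- Approximately stationary points for `∑ |w i| ^ (2 - τ)`, `τ < 1`, on an affine subspace
converge to its minimizer. -/
lemma exists_tendsto_of_approx_stationary {N d : ℕ} {X : Matrix (Fin N) (Fin d) ℝ}
    {y : Fin N → ℝ} (hτ : τ < 1) {l : Filter ℝ} [NeBot l] {w : ℝ → Fin d → ℝ} {ε : ℝ → ℝ}
    (hε : Tendsto ε l (𝓝 0)) (hε0 : ∀ᶠ a in l, 0 ≤ ε a) (hE : ∀ᶠ a in l, X.mulVec (w a) = y)
    (hw : ∀ᶠ a in l, ∀ v, X.mulVec v = y →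
      -(ε a * ∑ i, |v i - w a i|) ≤ ∑ i, signedPow τ (w a i) * (v i - w a i)) :
    ∃ x, (X.mulVec x = y ∧ ∀ v, X.mulVec v = y →
      ∑ i, |x i| ^ (2 - τ) ≤ ∑ i, |v i| ^ (2 - τ)) ∧ Tendsto w l (𝓝 x) := by
  have h1 : 1 < 2 - τ := by linarith
  have h0 : 0 < 2 - τ := by linarith
  have hineq : ∀ᶠ a in l, ∀ v, X.mulVec v = y → ∑ i, |w a i| ^ (2 - τ) ≤
      ∑ i, |v i| ^ (2 - τ) + (2 - τ) * (ε a * ∑ i, |v i - w a i|) := by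
    filter_upwards [hw] with a ha v hv
    have hs := Finset.sum_le_sum (s := Finset.univ) fun i _ =>
      signedPow_mul_sub_le hτ (v i) (w a i)
    rw [← Finset.mul_sum, Finset.sum_sub_distrib] at hs
    have := mul_le_mul_of_nonneg_left (ha v hv) h0.le
    linarith
  obtain ⟨a₀, hv₀⟩ := hE.exists
  set v₀ := w a₀
  set B := ∑ i, |v₀ i| ^ (2 - τ) + ∑ i, |v₀ i| + d with hB
  -- The error term contains `w a` itself; once `(2 - τ) * ε a ≤ 1 / 2`, half of `∑ |w a i|` absorbs
  -- it.
  have hbound : ∀ᶠ a in l, w a ∈ Metric.closedBall (0 : Fin d → ℝ) (d + 2 * B) := by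
    have hsmall : ∀ᶠ a in l, (2 - τ) * ε a ≤ 1 / 2 := by
      have := hε.const_mul (2 - τ)
      rw [mul_zero] at this
      exact this.eventually_le_const (by norm_num)
    filter_upwards [hineq, hsmall, hε0] with a ha hs h0a
    apply mem_closedBall_of_sum_abs_le
    have hS : ∑ i, |w a i| ≤ d + ∑ i, |w a i| ^ (2 - τ) := by
      have := Finset.sum_le_sum (s := Finset.univ) fun i _ =>
        abs_le_one_add_abs_rpow h1.le (w a i)
      simpa [Finset.sum_add_distrib] using this
    have hd : ∑ i, |v₀ i - w a i| ≤ ∑ i, |v₀ i| + ∑ i, |w a i| := by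
      rw [← Finset.sum_add_distrib]
      exact Finset.sum_le_sum fun i _ => abs_sub _ _
    have hd0 : 0 ≤ ∑ i, |v₀ i - w a i| := Finset.sum_nonneg fun i _ => abs_nonneg _
    have h2 := ha v₀ hv₀
    have h3 : (2 - τ) * (ε a * ∑ i, |v₀ i - w a i|) ≤ 1 / 2 * ∑ i, |v₀ i - w a i| := by
      rw [← mul_assoc]; exact mul_le_mul_of_nonneg_right hs hd0
    have h4 : 0 ≤ ∑ i, |v₀ i| := Finset.sum_nonneg fun i _ => abs_nonneg _
    have h5 : (0 : ℝ) ≤ d := Nat.cast_nonneg d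
    linarith
  refine exists_tendsto_of_unique_ultrafilter_limit (isCompact_closedBall _ _) hbound ?_ ?_
  · intro U hU x hx
    have hx' : ∀ i, Tendsto (fun a => w a i) U (𝓝 (x i)) := tendsto_pi_nhds.1 hx
    refine ⟨?_, fun v hv => ?_⟩
    · have hc : Continuous fun w : Fin d → ℝ => X.mulVec w := by fun_prop
      exact tendsto_nhds_unique_of_eventuallyEq ((hc.tendsto x).comp hx) tendsto_const_nhds
        (hU hE)
    · have hL : Tendsto (fun a => ∑ i, |w a i| ^ (2 - τ)) U (𝓝 (∑ i, |x i| ^ (2 - τ))) :=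
        tendsto_finsetSum _ fun i _ => (hx' i).abs.rpow_const (Or.inr h0.le)
      have hR : Tendsto (fun a => ∑ i, |v i| ^ (2 - τ) +
          (2 - τ) * (ε a * ∑ i, |v i - w a i|)) U (𝓝 (∑ i, |v i| ^ (2 - τ) +
          (2 - τ) * (0 * ∑ i, |v i - x i|))) :=
        tendsto_const_nhds.add (((hε.mono_left hU).mul
          (tendsto_finsetSum _ fun i _ => ((hx' i).const_sub (v i)).abs)).const_mul _)
      rw [zero_mul, mul_zero, add_zero] at hR
      exact le_of_tendsto_of_tendsto hL hR (hU (hineq.mono fun a ha => ha v hv))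
  · rintro x x' ⟨hx, hxm⟩ ⟨hx', hxm'⟩
    by_contra hne
    obtain ⟨i, hi⟩ := Function.ne_iff.1 hne
    have hlt := Finset.sum_lt_sum (s := Finset.univ)
      (fun i _ => abs_midpoint_rpow_le h1 (x i) (x' i))
      ⟨i, Finset.mem_univ i, abs_midpoint_rpow_lt h1 hi⟩
    rw [Finset.sum_add_distrib, ← Finset.mul_sum, ← Finset.mul_sum] at hlt
    have hm := hxm _ (mulVec_midpoint hx hx')
    have hm' := hxm' x hx
    simp only [Pi.smul_apply, Pi.add_apply, smul_eq_mul] at hm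
    linarith

end StrictlyConvexNorm

/-! ### The case `τ = 1`: hypentropy and entropic selection -/

section EntropicSelection

/-- The convex potential with derivative `arsinh (w / (2 α))`. -/
noncomputable def hypentropy (α w : ℝ) : ℝ :=
  w * Real.arsinh (w / (2 * α)) - √(w ^ 2 + (2 * α) ^ 2)

lemma cosh_sub_cosh_le (a b : ℝ) :
    Real.sinh b * (a - b) ≤ Real.cosh a - Real.cosh b := by
  have h1 : Real.exp b * (a - b + 1) ≤ Real.exp a := by
    have := mul_le_mul_of_nonneg_left (Real.add_one_le_exp (a - b)) (Real.exp_pos b).le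
    rwa [← Real.exp_add, add_sub_cancel] at this
  have h2 : Real.exp (-b) * (b - a + 1) ≤ Real.exp (-a) := by
    have := mul_le_mul_of_nonneg_left (Real.add_one_le_exp (b - a)) (Real.exp_pos (-b)).le
    rwa [← Real.exp_add, show -b + (b - a) = -a by ring] at this
  rw [Real.sinh_eq, Real.cosh_eq, Real.cosh_eq]
  linarith

lemma hypentropy_mul_sinh {α : ℝ} (hα : 0 < α) (a : ℝ) :
    hypentropy α (2 * α * Real.sinh a) = 2 * α * (a * Real.sinh a - Real.cosh a) := by
  have h : √((2 * α * Real.sinh a) ^ 2 + (2 * α) ^ 2) = 2 * α * Real.cosh a := by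
    rw [← Real.sqrt_sq (by have := Real.cosh_pos a; positivity : 0 ≤ 2 * α * Real.cosh a)]
    congr 1
    linear_combination (-(4 * α ^ 2)) * Real.cosh_sq a
  rw [hypentropy, h, mul_div_cancel_left₀ _ (by positivity), Real.arsinh_sinh]
  ring

/-- Up to scaling, the hypentropy is the Legendre dual of `cosh`: substituting `2 * α * sinh` for
both points turns its gradient inequality into that of `cosh`, with the points exchanged. -/
lemma arsinh_mul_sub_le {α : ℝ} (hα : 0 < α) (v w : ℝ) :
    Real.arsinh (w / (2 * α)) * (v - w) ≤ hypentropy α v - hypentropy α w := by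
  have key : ∀ x : ℝ, ∃ a, x = 2 * α * Real.sinh a := fun x =>
    ⟨Real.arsinh (x / (2 * α)), by rw [Real.sinh_arsinh]; field_simp⟩
  obtain ⟨a, rfl⟩ := key w
  obtain ⟨b, rfl⟩ := key v
  rw [hypentropy_mul_sinh hα, hypentropy_mul_sinh hα, mul_div_cancel_left₀ _ (by positivity),
    Real.arsinh_sinh]
  have := mul_le_mul_of_nonneg_left (cosh_sub_cosh_le a b) (by positivity : 0 ≤ 2 * α)
  linarith

/-- `hypentropy α w - |w| log (1 / α)`. -/
noncomputable def hypentropyRem (α w : ℝ) : ℝ :=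
  |w| * Real.log ((|w| + √(w ^ 2 + (2 * α) ^ 2)) / 2) - √(w ^ 2 + (2 * α) ^ 2)

lemma hypentropy_eq {α : ℝ} (hα : 0 < α) (w : ℝ) :
    hypentropy α w = |w| * -Real.log α + hypentropyRem α w := by
  have habs : w * Real.arsinh (w / (2 * α)) = |w| * Real.arsinh (|w| / (2 * α)) := by
    rcases abs_cases w with ⟨h, _⟩ | ⟨h, _⟩ <;> rw [h]
    rw [neg_div, Real.arsinh_neg, neg_mul_neg]
  have hs : √(1 + (|w| / (2 * α)) ^ 2) = √(w ^ 2 + (2 * α) ^ 2) / (2 * α) := by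
    rw [← Real.sqrt_sq (by positivity : 0 ≤ 2 * α), ← Real.sqrt_div (by positivity),
      Real.sqrt_sq (by positivity : 0 ≤ 2 * α), div_pow, sq_abs]
    congr 1
    field_simp
    ring
  have hpos : 0 < √(w ^ 2 + (2 * α) ^ 2) := Real.sqrt_pos.2 (by positivity)
  have hlog : Real.arsinh (|w| / (2 * α)) =
      Real.log ((|w| + √(w ^ 2 + (2 * α) ^ 2)) / 2) - Real.log α := by
    rw [Real.arsinh, hs, ← Real.log_div (by positivity) hα.ne']
    congr 1
    field_simp
  rw [hypentropy, hypentropyRem, habs, hlog]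
  ring

/-- The stationary point moves with `α`, so pointwise convergence of the remainder is not enough
there; this bound holds for all `w` at once. For a fixed competitor the pointwise limit suffices. -/
lemma le_hypentropyRem {α : ℝ} (hα : 0 < α) (w : ℝ) :
    |w| * Real.log |w| - |w| - 2 * α ≤ hypentropyRem α w := by
  have hup : √(w ^ 2 + (2 * α) ^ 2) ≤ |w| + 2 * α := by
    rw [Real.sqrt_le_left (by positivity), ← sq_abs w]
    nlinarith [mul_nonneg (abs_nonneg w) hα.le]
  have hlow : |w| ≤ √(w ^ 2 + (2 * α) ^ 2) := by
    rw [← Real.sqrt_sq_eq_abs]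
    exact Real.sqrt_le_sqrt (by nlinarith)
  have hmul : |w| * Real.log |w| ≤
      |w| * Real.log ((|w| + √(w ^ 2 + (2 * α) ^ 2)) / 2) := by
    rcases (abs_nonneg w).eq_or_lt with h | h
    · rw [← h, zero_mul, zero_mul]
    · exact mul_le_mul_of_nonneg_left (Real.log_le_log h (by linarith)) h.le
  rw [hypentropyRem]
  linarith

lemma tendsto_hypentropyRem (w : ℝ) :
    Tendsto (fun α => hypentropyRem α w) (𝓝 0) (𝓝 (|w| * Real.log |w| - |w|)) := by
  have hsq : Tendsto (fun α : ℝ => √(w ^ 2 + (2 * α) ^ 2)) (𝓝 0) (𝓝 |w|) := by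
    have hc : Continuous fun α : ℝ => √(w ^ 2 + (2 * α) ^ 2) := by fun_prop
    simpa [Real.sqrt_sq_eq_abs] using hc.tendsto 0
  rcases eq_or_ne w 0 with rfl | hw
  · simpa [hypentropyRem] using hsq.neg
  · have h1 := ((hsq.const_add |w|).div_const 2).log (by have := abs_pos.2 hw; positivity)
    rw [add_self_div_two] at h1
    exact (h1.const_mul _).sub hsq

lemma neg_one_le_mul_log_sub (x : ℝ) (hx : 0 ≤ x) : -1 ≤ x * Real.log x - x := by
  rcases hx.eq_or_lt with rfl | h
  · simp
  · have := mul_le_mul_of_nonneg_left (Real.one_sub_inv_le_log_of_pos h) hx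
    rw [mul_sub, mul_inv_cancel₀ h.ne'] at this
    linarith

/-- Two `ℓ¹`-minimizers on an affine subspace that both minimize the entropy `∑ |x| log |x| - |x|`
among all `ℓ¹`-minimizers are equal. -/
lemma entropic_minimizer_unique {N d : ℕ} {X : Matrix (Fin N) (Fin d) ℝ} {y : Fin N → ℝ}
    {x x' : Fin d → ℝ} (hx : X.mulVec x = y) (hx' : X.mulVec x' = y)
    (h1 : ∀ v, X.mulVec v = y → ∑ i, |x i| ≤ ∑ i, |v i|)
    (h1' : ∀ v, X.mulVec v = y → ∑ i, |x' i| ≤ ∑ i, |v i|)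
    (h2 : ∀ v, X.mulVec v = y → (∀ u, X.mulVec u = y → ∑ i, |v i| ≤ ∑ i, |u i|) →
      ∑ i, (|x i| * Real.log |x i| - |x i|) ≤ ∑ i, (|v i| * Real.log |v i| - |v i|))
    (h2' : ∀ v, X.mulVec v = y → (∀ u, X.mulVec u = y → ∑ i, |v i| ≤ ∑ i, |u i|) →
      ∑ i, (|x' i| * Real.log |x' i| - |x' i|) ≤ ∑ i, (|v i| * Real.log |v i| - |v i|)) :
    x = x' := by
  set m := (1 / 2 : ℝ) • (x + x') with hm
  have hmi : ∀ i, m i = 1 / 2 * (x i + x' i) := fun i => rfl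
  have hmE : X.mulVec m = y := mulVec_midpoint hx hx'
  have htri : ∀ i, |m i| ≤ 1 / 2 * |x i| + 1 / 2 * |x' i| := fun i => by
    rw [hmi, abs_mul, abs_of_pos (by norm_num : (0 : ℝ) < 1 / 2)]
    linarith [abs_add_le (x i) (x' i)]
  have hsum : ∑ i, (1 / 2 * |x i| + 1 / 2 * |x' i|) = 1 / 2 * ∑ i, |x i| + 1 / 2 * ∑ i, |x' i| := by
    rw [Finset.sum_add_distrib, Finset.mul_sum, Finset.mul_sum]
  have hmle := Finset.sum_le_sum (s := Finset.univ) fun i _ => htri i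
  have hxx' := h1 x' hx'
  have hx'x := h1' x hx
  -- Minimality leaves the midpoint no smaller `ℓ¹` norm, so the triangle inequality is tight in
  -- every coordinate.
  have heq : ∀ i, |m i| = 1 / 2 * |x i| + 1 / 2 * |x' i| := by
    have := (Finset.sum_eq_sum_iff_of_le (s := Finset.univ) fun i _ => htri i).1
      (le_antisymm hmle (by rw [hsum]; linarith [h1 m hmE]))
    exact fun i => this i (Finset.mem_univ i)
  have hmmin : ∀ u, X.mulVec u = y → ∑ i, |m i| ≤ ∑ i, |u i| := fun u hu => by
    rw [hsum] at hmle
    linarith [h1 u hu]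
  by_contra hne
  obtain ⟨i, hi⟩ := Function.ne_iff.1 hne
  -- Tightness rules out opposite nonzero entries, so strict convexity of `x log x` can be applied
  -- to absolute values.
  have habs : |x i| ≠ |x' i| := fun h => by
    rcases abs_eq_abs.1 h with h' | h'
    · exact hi h'
    · have := heq i
      rw [hmi, h', neg_add_cancel, mul_zero, abs_zero, abs_neg] at this
      have h0 : x' i = 0 := abs_eq_zero.1 (by linarith)
      exact hi (by rw [h', h0, neg_zero])
  have hlt : ∀ i, |x i| ≠ |x' i| → |m i| * Real.log |m i| - |m i| <
      1 / 2 * (|x i| * Real.log |x i| - |x i|) + 1 / 2 * (|x' i| * Real.log |x' i| - |x' i|) := by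
    intro i h
    have := Real.strictConvexOn_mul_log.2 (abs_nonneg (x i)) (abs_nonneg (x' i)) h
      (by norm_num : (0 : ℝ) < 1 / 2) (by norm_num : (0 : ℝ) < 1 / 2) (by norm_num)
    simp only [smul_eq_mul, ← heq i] at this
    have := heq i
    linarith
  have hle : ∀ i, |m i| * Real.log |m i| - |m i| ≤
      1 / 2 * (|x i| * Real.log |x i| - |x i|) + 1 / 2 * (|x' i| * Real.log |x' i| - |x' i|) := by
    intro i
    rcases eq_or_ne |x i| |x' i| with h | h
    · have : |m i| = |x' i| := by rw [heq, h]; ring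
      rw [h, this]; linarith
    · exact (hlt i h).le
  have hs := Finset.sum_lt_sum (s := Finset.univ) (fun i _ => hle i)
    ⟨i, Finset.mem_univ i, hlt i habs⟩
  rw [Finset.sum_add_distrib, ← Finset.mul_sum, ← Finset.mul_sum] at hs
  linarith [h2 m hmE hmmin, h2' x hx h1]

/-- Stationary points of the hypentropy on an affine subspace converge, as `α → 0`, to the
`ℓ¹`-minimizer of least `∑ |x| log |x|`. -/
lemma exists_tendsto_of_arsinh_stationary {N d : ℕ} {X : Matrix (Fin N) (Fin d) ℝ}
    {y : Fin N → ℝ} {w : ℝ → Fin d → ℝ}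
    (hE : ∀ᶠ α in 𝓝[>] (0 : ℝ), X.mulVec (w α) = y)
    (hw : ∀ᶠ α in 𝓝[>] (0 : ℝ), ∀ v, X.mulVec v = y →
      ∑ i, Real.arsinh (w α i / (2 * α)) * (v i - w α i) = 0) :
    ∃ x, X.mulVec x = y ∧ (∀ v, X.mulVec v = y → ∑ i, |x i| ≤ ∑ i, |v i|) ∧
      Tendsto w (𝓝[>] (0 : ℝ)) (𝓝 x) := by
  have hineq : ∀ᶠ α in 𝓝[>] (0 : ℝ), ∀ v, X.mulVec v = y →
      -Real.log α * ∑ i, |w α i| + ∑ i, (|w α i| * Real.log |w α i| - |w α i| - 2 * α) ≤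
      -Real.log α * ∑ i, |v i| + ∑ i, hypentropyRem α (v i) := by
    filter_upwards [hw, self_mem_nhdsWithin] with α ha (hα : 0 < α) v hv
    have hs := Finset.sum_le_sum (s := Finset.univ) fun i _ => arsinh_mul_sub_le hα (v i) (w α i)
    simp only [ha v hv, hypentropy_eq hα, Finset.sum_sub_distrib, Finset.sum_add_distrib,
      ← Finset.sum_mul] at hs
    have := Finset.sum_le_sum (s := Finset.univ) fun i _ => le_hypentropyRem hα (w α i)
    linarith
  have hlog : Tendsto (fun α => -Real.log α) (𝓝[>] 0) atTop :=
    tendsto_neg_atBot_atTop.comp Real.tendsto_log_nhdsGT_zero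
  have hid : Tendsto (fun α : ℝ => α) (𝓝[>] 0) (𝓝 0) := tendsto_nhdsWithin_of_tendsto_nhds tendsto_id
  have hrem : ∀ v : Fin d → ℝ, Tendsto (fun α => ∑ i, hypentropyRem α (v i)) (𝓝[>] 0)
      (𝓝 (∑ i, (|v i| * Real.log |v i| - |v i|))) := fun v =>
    tendsto_finsetSum _ fun i _ => (tendsto_hypentropyRem (v i)).comp hid
  obtain ⟨a₀, hv₀⟩ := hE.exists
  set v₀ := w a₀
  have hbound : ∀ᶠ α in 𝓝[>] (0 : ℝ),
      w α ∈ Metric.closedBall (0 : Fin d → ℝ) (∑ i, |v₀ i| + 1) := by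
    have hlow : Tendsto (fun α : ℝ => (d : ℝ) * (1 + 2 * α)) (𝓝[>] 0)
        (𝓝 (d * (1 + 2 * 0))) := ((hid.const_mul 2).const_add 1).const_mul _
    have hsmall := ((hrem v₀).add hlow).div_atTop hlog
    filter_upwards [hineq, hsmall.eventually_le_const zero_lt_one,
      hlog.eventually_gt_atTop 0] with α ha hs hL
    apply mem_closedBall_of_sum_abs_le
    rw [div_le_one hL] at hs
    have hent : -((d : ℝ) * (1 + 2 * α)) ≤
        ∑ i, (|w α i| * Real.log |w α i| - |w α i| - 2 * α) := by
      have := Finset.sum_le_sum (s := Finset.univ) fun i _ =>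
        sub_le_sub_right (neg_one_le_mul_log_sub |w α i| (abs_nonneg _)) (2 * α)
      simp only [Finset.sum_const, Finset.card_univ, Fintype.card_fin, nsmul_eq_mul] at this
      linarith
    have h := ha v₀ hv₀
    refine le_of_mul_le_mul_left ?_ hL
    linarith
  obtain ⟨x, ⟨hx, hx1, -⟩, hxt⟩ := exists_tendsto_of_unique_ultrafilter_limit
    (isCompact_closedBall _ _) hbound
    (P := fun x => X.mulVec x = y ∧ (∀ v, X.mulVec v = y → ∑ i, |x i| ≤ ∑ i, |v i|) ∧
      ∀ v, X.mulVec v = y → (∀ u, X.mulVec u = y → ∑ i, |v i| ≤ ∑ i, |u i|) →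
      ∑ i, (|x i| * Real.log |x i| - |x i|) ≤ ∑ i, (|v i| * Real.log |v i| - |v i|))
    (fun U hU x hx => by
      have hx' : ∀ i, Tendsto (fun a => w a i) U (𝓝 (x i)) := tendsto_pi_nhds.1 hx
      have hsum : Tendsto (fun α => ∑ i, |w α i|) U (𝓝 (∑ i, |x i|)) :=
        tendsto_finsetSum _ fun i _ => (hx' i).abs
      have hent : Tendsto (fun α => ∑ i, (|w α i| * Real.log |w α i| - |w α i| - 2 * α)) U
          (𝓝 (∑ i, (|x i| * Real.log |x i| - |x i|))) := by
        refine tendsto_finsetSum _ fun i _ => ?_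
        have := (((Real.continuous_mul_log.tendsto _).comp (hx' i).abs).sub (hx' i).abs).sub
          ((hid.mono_left hU).const_mul 2)
        rwa [mul_zero, sub_zero] at this
      refine ⟨?_, fun v hv => ?_, fun v hv hvm => ?_⟩
      · have hc : Continuous fun w : Fin d → ℝ => X.mulVec w := by fun_prop
        exact tendsto_nhds_unique_of_eventuallyEq ((hc.tendsto x).comp hx) tendsto_const_nhds
          (hU hE)
      -- Division by `-log α → ∞` removes everything except the `ℓ¹` norms.
      · have hR := tendsto_const_nhds (x := ∑ i, |v i|).add
          ((((hrem v).mono_left hU).sub hent).div_atTop (hlog.mono_left hU))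
        rw [add_zero] at hR
        refine le_of_tendsto_of_tendsto hsum hR ?_
        filter_upwards [hU hineq, hU (hlog.eventually_gt_atTop 0)] with α ha hL
        rw [← sub_le_iff_le_add', le_div_iff₀ hL]
        linarith [ha v hv]
      -- For an `ℓ¹`-minimal competitor the leading terms compare in the favourable direction at
      -- every `α`, so they drop out without dividing and leave the entropies.
      · refine le_of_tendsto_of_tendsto hent ((hrem v).mono_left hU) ?_
        filter_upwards [hU hineq, hU (hlog.eventually_gt_atTop 0), hU hE] with α ha hL hEα
        have := mul_le_mul_of_nonneg_left (hvm _ hEα) (le_of_lt hL)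
        linarith [ha v hv])
    (fun x x' h h' => entropic_minimizer_unique h.1 h'.1 h.2.1 h'.2.1 h.2.2 h'.2.2)
  exact ⟨x, hx, hx1, hxt⟩

end EntropicSelection

end TemperedEGU

theorem corollary1 {N d : ℕ} (hNd : N < d) (X : Matrix (Fin N) (Fin d) ℝ) (y : Fin N → ℝ)
    (η τ : ℝ) (hη : 0 < η) (hτ0 : 0 ≤ τ) (hτ1 : τ ≤ 1)
    -- for each initial scale `α`, the trajectory `(u₊, u₋)` and the limit `w(∞)` of its weights
    (up um : ℝ → ℝ → Fin d → ℝ) (winf : ℝ → Fin d → ℝ)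
    (hflow : ∀ᶠ α in 𝓝[>] (0 : ℝ), TemperedEGU.IsGradientFlow X y η τ α (up α) (um α))
    (hclip : τ < 1 →
      ∀ᶠ α in 𝓝[>] (0 : ℝ), TemperedEGU.FollowsClipping X y η τ α (up α) (um α))
    (hlim : ∀ᶠ α in 𝓝[>] (0 : ℝ),
      Tendsto (TemperedEGU.weights τ (up α) (um α)) atTop (𝓝 (winf α)))
    (hE : ∀ᶠ α in 𝓝[>] (0 : ℝ), X.mulVec (winf α) = y) :
    ∃ wstar : Fin d → ℝ,
      X.mulVec wstar = y ∧
      (∀ w : Fin d → ℝ, X.mulVec w = y →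
        TemperedEGU.lpNorm (2 - τ) wstar ≤ TemperedEGU.lpNorm (2 - τ) w) ∧
      Tendsto winf (𝓝[>] (0 : ℝ)) (𝓝 wstar) := by
  rcases hτ1.eq_or_lt with rfl | hτ
  · obtain ⟨x, hx, hxm, hxt⟩ := TemperedEGU.exists_tendsto_of_arsinh_stationary hE (by
      filter_upwards [hflow, hlim, hE, self_mem_nhdsWithin] with α hf hl he hα v hv
      exact TemperedEGU.sum_arsinh_mul_eq_zero hα hf hl he hv)
    refine ⟨x, hx, fun w hw => TemperedEGU.lpNorm_le_lpNorm (by norm_num) ?_, hxt⟩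
    have h1 : (2 : ℝ) - 1 = 1 := by norm_num
    simpa only [h1, Real.rpow_one] using hxm w hw
  · have hε : Tendsto (fun α : ℝ => 2 * α ^ (1 - τ)) (𝓝[>] 0) (𝓝 0) := by
      have hc : ContinuousAt (fun α : ℝ => 2 * α ^ (1 - τ)) 0 :=
        continuousAt_const.mul (Real.continuousAt_rpow_const _ _ (Or.inr (by linarith)))
      have := hc.tendsto
      rw [Real.zero_rpow (by linarith), mul_zero] at this
      exact tendsto_nhdsWithin_of_tendsto_nhds this
    obtain ⟨x, ⟨hx, hxm⟩, hxt⟩ := TemperedEGU.exists_tendsto_of_approx_stationary hτ hε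
      (by
        filter_upwards [self_mem_nhdsWithin] with α (hα : 0 < α)
        positivity) hE (by
        filter_upwards [hflow, hclip hτ, hlim, hE, self_mem_nhdsWithin] with α hf hc hl he hα v hv
        exact TemperedEGU.neg_le_sum_signedPow_mul hτ0 hτ hα hf hc hl he hv)
    exact ⟨x, hx, fun w hw => TemperedEGU.lpNorm_le_lpNorm (by linarith) (hxm w hw), hxt⟩
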